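/- Let $k$ be a field and let $H$ be a Hopf algebra over $k$, possibly infinite dimensional, with comultiplication $\Delta(h)=h_1\otimes h_2$, counit $\varepsilon$ and antipode $S$. A functional $\lambda\in H^*$ is a left (right) integral if $h_1\lambda(h_2)=\lambda(h)1$ (respectively $\lambda(h_1)h_2=\lambda(h)1$) for all $h\in H$. Assume that $H$ is co-Frobenius, i.e. that there is a nonzero left or a nonzero right integral in $H^*$. Let $a\in G(H)$ and $\alpha\in G(H^0)$ be the modular elements of $H$: $a$ is the grouplike element such that $\lambda(h_1)h_2=\lambda(h)a^{-1}$ for all left integrals $\lambda$ and all $h\in H$; and $\alpha=\varepsilon\circ\chi$, an algebra map $H\to k$, where $\chi$ is the algebra automorphism of $H$ such that $\lambda(mh)=\lambda(\chi(h)m)$ for all left integrals $\lambda$ and all $h,m\in H$. Let $R=R^1\otimes R^2\in H\otimes H$ be invertible and such that $(H,R)$ is quasitriangular: $\Delta^{\mathrm{cop}}(h)=R\Delta(h)R^{-1}$ for all $h\in H$, $(\Delta\otimes\mathrm{id})(R)=R_{13}R_{23}$, $(\mathrm{id}\otimes\Delta)(R)=R_{13}R_{12}$, $\varepsilon(R^1)R^2=1$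 and $\varepsilon(R^2)R^1=1$. Put $u=S(R^2)R^1$, and, for an algebra map $\eta:H\to k$ with convolution inverse $\eta^{-1}=\eta\circ S$, put $a_\eta=\eta(R^1)R^2$ and $b_\eta=\eta^{-1}(R^2)R^1$. Then $S(u)$ is invertible, and with $v=S(u)^{-1}$ one has $$uv=vu=a\,b_\alpha=a\,a_\alpha .$$ Moreover, $a_\alpha=b_\alpha$. -/

import Mathlib

open scoped TensorProduct

namespace CoFrob

noncomputable section

/-- The space of left integrals in the dual `H^*` of a Hopf algebra `H`: the functionals `Λ` with
`h₁ Λ(h₂) = Λ(h) 1` for all `h` (equivalently `f * Λ = f(1) Λ` for all `f` in `H^*`, where `*` is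
the convolution product). -/
def leftIntegrals (k H : Type*) [Field k] [Ring H] [HopfAlgebra k H] :
    Submodule k (H →ₗ[k] k) where
  carrier := {Λ | ∀ h : H,
    TensorProduct.rid k H (Λ.lTensor H (Coalgebra.comul (R := k) h)) = Λ h • (1 : H)}
  add_mem' := by
    intro Λ M hΛ hM h
    simp only [Set.mem_ofPred_eq] at hΛ hM
    simp [LinearMap.lTensor_add, hΛ h, hM h, add_smul]
  zero_mem' := by
    intro h
    simp
  smul_mem' := by
    intro c Λ hΛ h
    simp only [Set.mem_ofPred_eq] at hΛ
    simp [LinearMap.lTensor_smul, hΛ h, smul_smul]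

/-- The space of right integrals in the dual `H^*` of a Hopf algebra `H`: the functionals `Λ` with
`Λ(h₁) h₂ = Λ(h) 1` for all `h` (equivalently `Λ * f = f(1) Λ` for all `f` in `H^*`). -/
def rightIntegrals (k H : Type*) [Field k] [Ring H] [HopfAlgebra k H] :
    Submodule k (H →ₗ[k] k) where
  carrier := {Λ | ∀ h : H,
    TensorProduct.lid k H (Λ.rTensor H (Coalgebra.comul (R := k) h)) = Λ h • (1 : H)}
  add_mem' := by
    intro Λ M hΛ hM h
    simp only [Set.mem_ofPred_eq] at hΛ hM
    simp [LinearMap.rTensor_add, hΛ h, hM h, add_smul]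
  zero_mem' := by
    intro h
    simp
  smul_mem' := by
    intro c Λ hΛ h
    simp only [Set.mem_ofPred_eq] at hΛ
    simp [LinearMap.rTensor_smul, hΛ h, smul_smul]

/-- A Hopf algebra over a field, of any dimension, is co-Frobenius if it has a nonzero left or a
nonzero right integral in its dual. -/
def IsCoFrobenius (k H : Type*) [Field k] [Ring H] [HopfAlgebra k H] : Prop :=
  leftIntegrals k H ≠ ⊥ ∨ rightIntegrals k H ≠ ⊥

/-- The grouplike element `a` is the modular (distinguished grouplike) element of `H`:
`Λ(h₁) h₂ = Λ(h) a⁻¹` for all left integrals `Λ` and all `h`. If there is a nonzero left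
integral, this equation determines `a`. -/
def IsModularElement {k H : Type*} [Field k] [Ring H] [HopfAlgebra k H]
    (a : GroupLike k H) : Prop :=
  ∀ Λ ∈ leftIntegrals k H, ∀ h : H,
    TensorProduct.lid k H (Λ.rTensor H (Coalgebra.comul (R := k) h)) =
      Λ h • ((a⁻¹ : GroupLike k H) : H)

/-- The algebra automorphism `χ` is the generalized Frobenius (Nakayama) automorphism of `H`:
`h ⇀ Λ = Λ ↼ χ(h)`, i.e. `Λ(m h) = Λ(χ(h) m)`, for all left integrals `Λ` and all `h`, `m`. -/
def IsFrobeniusAutomorphism {k H : Type*} [Field k] [Ring H] [HopfAlgebra k H]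
    (χ : H ≃ₐ[k] H) : Prop :=
  ∀ Λ ∈ leftIntegrals k H, ∀ h m : H, Λ (m * h) = Λ (χ h * m)

/-- The algebra map `α : H → k` is the modular element of `H` in `H^*`: `α = ε ∘ χ`, where `χ` is
the generalized Frobenius automorphism. -/
def IsModularFunctional {k H : Type*} [Field k] [Ring H] [HopfAlgebra k H]
    (α : H →ₐ[k] k) : Prop :=
  ∃ χ : H ≃ₐ[k] H, IsFrobeniusAutomorphism χ ∧
    α = (Bialgebra.counitAlgHom k H).comp (χ : H →ₐ[k] H)

/-- `R₁₂ = R¹ ⊗ R² ⊗ 1`. -/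
def leg12 {k H : Type*} [Field k] [Ring H] [HopfAlgebra k H] (R : H ⊗[k] H) :
    H ⊗[k] (H ⊗[k] H) :=
  Algebra.TensorProduct.map (AlgHom.id k H)
    (Algebra.TensorProduct.includeLeft : H →ₐ[k] H ⊗[k] H) R

/-- `R₁₃ = R¹ ⊗ 1 ⊗ R²`. -/
def leg13 {k H : Type*} [Field k] [Ring H] [HopfAlgebra k H] (R : H ⊗[k] H) :
    H ⊗[k] (H ⊗[k] H) :=
  Algebra.TensorProduct.map (AlgHom.id k H)
    (Algebra.TensorProduct.includeRight : H →ₐ[k] H ⊗[k] H) R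

/-- `R₂₃ = 1 ⊗ R¹ ⊗ R²`. -/
def leg23 {k H : Type*} [Field k] [Ring H] [HopfAlgebra k H] (R : H ⊗[k] H) :
    H ⊗[k] (H ⊗[k] H) :=
  (1 : H) ⊗ₜ[k] R

/-- `(H, R)` is quasitriangular, for an invertible element `R` of `H ⊗ H`. -/
structure IsQuasitriangular {k H : Type*} [Field k] [Ring H] [HopfAlgebra k H]
    (R : (H ⊗[k] H)ˣ) : Prop where
  /-- `Δ^cop(h) = R Δ(h) R⁻¹`. -/
  comul_cop : ∀ h : H, TensorProduct.comm k H H (Coalgebra.comul (R := k) h) =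
    (R : H ⊗[k] H) * Coalgebra.comul (R := k) h * ((R⁻¹ : (H ⊗[k] H)ˣ) : H ⊗[k] H)
  /-- `(Δ ⊗ id)(R) = R₁₃ R₂₃`. -/
  comul_left : TensorProduct.assoc k H H H
    ((Coalgebra.comul (R := k) (A := H)).rTensor H (R : H ⊗[k] H)) =
      leg13 (R : H ⊗[k] H) * leg23 (R : H ⊗[k] H)
  /-- `(id ⊗ Δ)(R) = R₁₃ R₁₂`. -/
  comul_right : (Coalgebra.comul (R := k) (A := H)).lTensor H (R : H ⊗[k] H) =
    leg13 (R : H ⊗[k] H) * leg12 (R : H ⊗[k] H)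
  /-- `ε(R¹) R² = 1`. -/
  counit_left : TensorProduct.lid k H
    ((Coalgebra.counit (R := k) (A := H)).rTensor H (R : H ⊗[k] H)) = 1
  /-- `ε(R²) R¹ = 1`. -/
  counit_right : TensorProduct.rid k H
    ((Coalgebra.counit (R := k) (A := H)).lTensor H (R : H ⊗[k] H)) = 1

/-- The Drinfeld element `u = S(R²) R¹`. -/
def drinfeldU {k H : Type*} [Field k] [Ring H] [HopfAlgebra k H] (R : H ⊗[k] H) : H :=
  LinearMap.mul' k H ((HopfAlgebra.antipode k (A := H)).rTensor H (TensorProduct.comm k H H R))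

/-- The element `v = S(u)⁻¹` (with the value `0` if `S(u)` is not invertible). -/
def drinfeldV {k H : Type*} [Field k] [Ring H] [HopfAlgebra k H] (R : H ⊗[k] H) : H :=
  Ring.inverse (HopfAlgebra.antipode k (drinfeldU R))

/-- `a_η = η(R¹) R²`, for an algebra map `η : H → k`. -/
def aElem {k H : Type*} [Field k] [Ring H] [HopfAlgebra k H] (R : H ⊗[k] H)
    (η : H →ₐ[k] k) : H :=
  TensorProduct.lid k H (η.toLinearMap.rTensor H R)

/-- The convolution inverse `η⁻¹ = η ∘ S` of an algebra map `η : H → k`. -/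
def convInverse {k H : Type*} [Field k] [Ring H] [HopfAlgebra k H] (η : H →ₐ[k] k) :
    H →ₗ[k] k :=
  η.toLinearMap ∘ₗ HopfAlgebra.antipode k

theorem convInverse_mul {k H : Type*} [Field k] [Ring H] [HopfAlgebra k H] (η : H →ₐ[k] k) :
    WithConv.toConv (convInverse η) * WithConv.toConv η.toLinearMap = 1 := by
  ext h
  rw [(Coalgebra.Repr.arbitrary k h).convMul_apply]
  simp only [convInverse, LinearMap.comp_apply, AlgHom.toLinearMap_apply,
    ← map_mul, ← map_sum, HopfAlgebra.sum_antipode_mul_eq_algebraMap_counit]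
  simp

theorem mul_convInverse {k H : Type*} [Field k] [Ring H] [HopfAlgebra k H] (η : H →ₐ[k] k) :
    WithConv.toConv η.toLinearMap * WithConv.toConv (convInverse η) = 1 := by
  ext h
  rw [(Coalgebra.Repr.arbitrary k h).convMul_apply]
  simp only [convInverse, LinearMap.comp_apply, AlgHom.toLinearMap_apply,
    ← map_mul, ← map_sum, HopfAlgebra.sum_mul_antipode_eq_algebraMap_counit]
  simp

/-- `b_η = η⁻¹(R²) R¹`, for an algebra map `η : H → k` with convolution inverse `η⁻¹`. -/
def bElem {k H : Type*} [Field k] [Ring H] [HopfAlgebra k H] (R : H ⊗[k] H)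
    (η : H →ₐ[k] k) : H :=
  TensorProduct.rid k H ((convInverse η).lTensor H R)

end

end CoFrob

/-!
Write `u = S(R²) R¹` for the Drinfeld element and let `Λ` be a nonzero left integral.

The relation between `u` and the modular elements comes from applying `Λ` to the first tensor
factor of `R Δ(x) = Δ^cop(x) R`. The axiom `(Δ ⊗ id)(R) = R₁₃ R₂₃` and the identities `R² u R¹ = 1`,
`R¹ S(u) R² = 1` give `R = (1 ⊗ R² u) Δ(R¹)` and `R₂₁ = Δ(R¹) (S(u) R² ⊗ 1)`. The left-hand side
thus becomes `Λ(R¹ x) R² u a⁻¹`, by the definition of `a`, and the right-hand side becomes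
`Λ(x R¹) S(u) R² = Λ(χ(R¹) x) S(u) R²`. As `Λ` is nondegenerate (`eq_zero_of_integral_mul_eq_zero`),
`Λ(- x)` can be cancelled, and the counit on the first factor yields `u a⁻¹ = S(u) a_α`, because
`α = ε ∘ χ`. This is `mul_inv_modularElement_eq`.

The same argument applies to `R₂₁⁻¹ = R² ⊗ S(R¹)`, for which `S(u)⁻¹` and `u⁻¹` take the places of
`u` and `S(u)`, and yields `S(u)⁻¹ a⁻¹ = u⁻¹ b_α`. As `u` and `S(u)` commute with each other and
with `a`, the two identities give `a_α = b_α` and `u S(u)⁻¹ = a a_α`.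

The facts on `u` are those of Drinfeld: `S²(x) u = u x` (`drinfeldU_mul`), so that `S` is surjective,
and a nonzero right integral `ρ` gives the nonzero left integral `ρ ∘ S`
(`comp_antipode_mem_leftIntegrals`).

Throughout, `R` is written as a finite sum of pure tensors `r i ⊗ₜ s i`.
-/

open scoped TensorProduct

namespace CoFrob

open Coalgebra HopfAlgebra TensorProduct

/-! ### Sweedler identities in a Hopf algebra -/

section HopfIdentities

variable {k H : Type*} [Field k] [Ring H] [HopfAlgebra k H]

theorem sum_counit_smul_left {x : H} {ι : Type*} (𝓡 : Repr k x ι) :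
    ∑ i ∈ 𝓡.index, counit (R := k) (𝓡.right i) • 𝓡.left i = x := by
  simpa only [map_sum, TensorProduct.rid_tmul, one_smul] using
    congrArg (TensorProduct.rid k H) (sum_tmul_counit_eq 𝓡)

/-- `(S(x₁) ⊗ 1) Δ(x₂) = 1 ⊗ x`. -/
theorem sum_antipode_tmul_one_mul_comul {x : H} {ι : Type*} (𝓡 : Repr k x ι) :
    ∑ i ∈ 𝓡.index, (antipode k (𝓡.left i) ⊗ₜ[k] (1 : H)) * comul (R := k) (𝓡.right i) =
      1 ⊗ₜ[k] x := by
  have h := congrArg (TensorProduct.map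
      (LinearMap.mul' k H ∘ₗ (antipode k (A := H)).rTensor H) LinearMap.id ∘ₗ
        (TensorProduct.assoc k H H H).symm.toLinearMap)
    (sum_tmul_tmul_eq 𝓡 (fun i => ℛ k (𝓡.left i)) (fun i => ℛ k (𝓡.right i)))
  simp only [map_sum, LinearMap.comp_apply, LinearEquiv.coe_coe, TensorProduct.assoc_symm_tmul,
    TensorProduct.map_tmul, LinearMap.rTensor_tmul, LinearMap.mul'_apply, LinearMap.id_apply,
    ← TensorProduct.sum_tmul, sum_antipode_mul_eq_smul, TensorProduct.smul_tmul] at h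
  rw [← TensorProduct.tmul_sum, sum_counit_smul] at h
  rw [h]
  refine Finset.sum_congr rfl fun i _ => ?_
  conv_lhs => rw [← (ℛ k (𝓡.right i)).eq]
  simp [Finset.mul_sum]

/-- `(1 ⊗ x₁) Δ(S(x₂)) = S(x) ⊗ 1`. This is all that is needed of the anti-comultiplicativity of
the antipode. -/
theorem sum_one_tmul_mul_comul_antipode {x : H} {ι : Type*} (𝓡 : Repr k x ι) :
    ∑ i ∈ 𝓡.index, ((1 : H) ⊗ₜ[k] 𝓡.left i) * comul (R := k) (antipode k (𝓡.right i)) =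
      antipode k x ⊗ₜ[k] 1 := by
  let F : H ⊗[k] (H ⊗[k] H) →ₗ[k] H ⊗[k] H :=
    LinearMap.mul' k (H ⊗[k] H) ∘ₗ TensorProduct.map
      ((TensorProduct.mk k H H).flip 1 ∘ₗ antipode k)
      (comul ∘ₗ LinearMap.mul' k H ∘ₗ (antipode k (A := H)).lTensor H)
  have h := congrArg F
    (sum_tmul_tmul_eq 𝓡 (fun i => ℛ k (𝓡.left i)) (fun i => ℛ k (𝓡.right i)))
  simp only [F, map_sum, LinearMap.comp_apply, TensorProduct.map_tmul, LinearMap.lTensor_tmul,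
    LinearMap.mul'_apply, LinearMap.flip_apply, TensorProduct.mk_apply] at h
  have hl (i : ι) : ∑ j ∈ (ℛ k (𝓡.left i)).index,
      (antipode k ((ℛ k (𝓡.left i)).left j) ⊗ₜ[k] (1 : H)) *
        comul (R := k) ((ℛ k (𝓡.left i)).right j * antipode k (𝓡.right i)) =
      ((1 : H) ⊗ₜ[k] 𝓡.left i) * comul (R := k) (antipode k (𝓡.right i)) := by
    simp only [Bialgebra.comul_mul, ← mul_assoc, ← Finset.sum_mul,
      sum_antipode_tmul_one_mul_comul]
  have hr (i : ι) : ∑ j ∈ (ℛ k (𝓡.right i)).index,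
      (antipode k (𝓡.left i) ⊗ₜ[k] (1 : H)) *
        comul (R := k) ((ℛ k (𝓡.right i)).left j * antipode k ((ℛ k (𝓡.right i)).right j)) =
      antipode k (counit (R := k) (𝓡.right i) • 𝓡.left i) ⊗ₜ[k] 1 := by
    rw [← Finset.mul_sum, ← map_sum, sum_mul_antipode_eq_smul]
    simp [TensorProduct.smul_tmul']
  rw [Finset.sum_congr rfl fun i _ => hl i, Finset.sum_congr rfl fun i _ => hr i,
    ← TensorProduct.sum_tmul, ← map_sum, sum_counit_smul_left] at h
  exact h

end HopfIdentities

/-! ### Integrals -/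

section Integrals

variable {k H : Type*} [Field k] [Ring H] [HopfAlgebra k H]

theorem comp_antipode_mem_leftIntegrals {Λ : H →ₗ[k] k} (hΛ : Λ ∈ rightIntegrals k H) :
    Λ ∘ₗ antipode k ∈ leftIntegrals k H := by
  intro h
  have key := congrArg ((TensorProduct.lid k H).toLinearMap ∘ₗ Λ.rTensor H)
    (sum_one_tmul_mul_comul_antipode (ℛ k h))
  have hmul (y : H) (z : H ⊗[k] H) :
      TensorProduct.lid k H (Λ.rTensor H ((1 ⊗ₜ y) * z)) =
        y * TensorProduct.lid k H (Λ.rTensor H z) := by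
    induction z with
    | zero => simp
    | tmul b c => simp
    | add a b ha hb => simp [mul_add, ha, hb]
  simp only [map_sum, LinearMap.comp_apply, LinearEquiv.coe_coe, hmul] at key
  simp only [hΛ _] at key
  conv_lhs => rw [← (ℛ k h).eq]
  simpa using key

/-- `Λ(x y₂) y₁ = Λ(x₂ y) S(x₁)` for a left integral `Λ`. -/
theorem sum_left_smul_integral {Λ : H →ₗ[k] k} (hΛ : Λ ∈ leftIntegrals k H) (x y : H)
    {ι κ : Type*} (𝓡 : Repr k x ι) (𝓢 : Repr k y κ) :
    ∑ i ∈ 𝓢.index, Λ (x * 𝓢.right i) • 𝓢.left i =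
      ∑ i ∈ 𝓡.index, Λ (𝓡.right i * y) • antipode k (𝓡.left i) := by
  have key := congrArg (fun z => ((TensorProduct.rid k H).toLinearMap ∘ₗ Λ.lTensor H) (z * comul y))
    (sum_antipode_tmul_one_mul_comul 𝓡)
  have hmul (y : H) (z : H ⊗[k] H) :
      TensorProduct.rid k H (Λ.lTensor H ((y ⊗ₜ 1) * z)) =
        y * TensorProduct.rid k H (Λ.lTensor H z) := by
    induction z with
    | zero => simp
    | tmul b c => simp
    | add a b ha hb => simp [mul_add, ha, hb]
  simp only [Finset.sum_mul, mul_assoc, ← Bialgebra.comul_mul, map_sum, LinearMap.comp_apply,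
    LinearEquiv.coe_coe, hmul] at key
  simp only [hΛ _] at key
  rw [← 𝓢.eq] at key
  simpa [Finset.mul_sum] using key.symm

/-- Nondegeneracy of a nonzero left integral `Λ`. The annihilator `N = {y | Λ(H y) = 0}` is a left
ideal with `Δ(N) ⊆ H ⊗ N`; a nonzero counit on `N` would give `1 ∈ N`, that is, `Λ = 0`, and
`ε(N) = 0` gives `y = ε(y₂) y₁ = 0` for `y ∈ N`. -/
theorem eq_zero_of_integral_mul_eq_zero {Λ : H →ₗ[k] k} (hΛ : Λ ∈ leftIntegrals k H)
    (h0 : Λ ≠ 0) {y : H} (hy : ∀ x, Λ (x * y) = 0) : y = 0 := by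
  let b := Module.Basis.ofVectorSpace k H
  -- Expanding along a basis of `H` shows that the annihilator of `Λ` is a left coideal.
  have hrepr (z : H) (hz : ∀ x, Λ (x * z) = 0) :
      ∃ 𝓢 : Repr k z (Module.Basis.ofVectorSpaceIndex k H),
        ∀ i ∈ 𝓢.index, ∀ x, Λ (x * 𝓢.right i) = 0 := by
    obtain ⟨n, hn⟩ := TensorProduct.eq_repr_basis_left b (comul (R := k) z)
    let 𝓢 : Repr k z (Module.Basis.ofVectorSpaceIndex k H) := ⟨n.support, b, n, hn⟩
    refine ⟨𝓢, fun i hi x => ?_⟩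
    have h := sum_left_smul_integral hΛ x z (ℛ k x) 𝓢
    simp only [hz, zero_smul, Finset.sum_const_zero] at h
    exact linearIndependent_iff'.mp b.linearIndependent n.support _ h i hi
  have hcounit (z : H) (hz : ∀ x, Λ (x * z) = 0) : counit (R := k) z = 0 := by
    obtain ⟨𝓢, h𝓢⟩ := hrepr z hz
    by_contra hne
    refine h0 (LinearMap.ext fun x => ?_)
    have h := congrArg (fun w => Λ (x * w)) (sum_antipode_mul_eq_smul 𝓢)
    simp only [Finset.mul_sum, map_sum, ← mul_assoc, Finset.sum_congr rfl fun i hi => h𝓢 i hi _,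
      Finset.sum_const_zero, mul_smul_comm, map_smul, mul_one, smul_eq_mul] at h
    simpa [hne] using h.symm
  obtain ⟨𝓢, h𝓢⟩ := hrepr y hy
  rw [← sum_counit_smul_left 𝓢]
  exact Finset.sum_eq_zero fun i hi => by rw [hcounit _ (h𝓢 i hi), zero_smul]

end Integrals
/-! ### The integral applied to the R-matrix relation -/

section RMatrix

variable {k H : Type*} [Field k] [Ring H] [HopfAlgebra k H] {ι : Type*} [Fintype ι]

/-- If `(Δ ⊗ id)(R) = R₁₃ R₂₃` and `R² p R¹ = 1`, then `R = (1 ⊗ R² p) Δ(R¹)`. -/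
theorem sum_one_tmul_mul_comul_left {r s : ι → H}
    (hΔ : ∑ i, TensorProduct.assoc k H H H (comul (R := k) (r i) ⊗ₜ[k] s i) =
      ∑ i, ∑ j, r i ⊗ₜ[k] (r j ⊗ₜ[k] (s i * s j)))
    {p : H} (hp : ∑ i, s i * p * r i = 1) :
    ∑ i, ((1 : H) ⊗ₜ[k] (s i * p)) * comul (R := k) (r i) = ∑ i, r i ⊗ₜ[k] s i := by
  let F : H ⊗[k] (H ⊗[k] H) →ₗ[k] H ⊗[k] H :=
    (LinearMap.mul' k H ∘ₗ (TensorProduct.comm k H H).toLinearMap ∘ₗ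
      (LinearMap.mulRight k p).lTensor H).lTensor H
  have hF (z : H ⊗[k] H) (c : H) :
      F (TensorProduct.assoc k H H H (z ⊗ₜ c)) = (1 ⊗ₜ (c * p)) * z := by
    induction z with
    | zero => simp
    | tmul a b => simp [F]
    | add a b ha hb => rw [TensorProduct.add_tmul, map_add, map_add, ha, hb, mul_add]
  have h := congrArg F hΔ
  simp only [map_sum, hF] at h
  rw [h]
  refine Finset.sum_congr rfl fun i _ => ?_
  simp only [F, LinearMap.lTensor_tmul, LinearMap.comp_apply, LinearEquiv.coe_coe,
    TensorProduct.comm_tmul, LinearMap.mul'_apply, LinearMap.mulRight_apply, mul_assoc,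
    ← TensorProduct.tmul_sum, ← Finset.mul_sum]
  simp only [← mul_assoc, hp, mul_one]

/-- If `(Δ ⊗ id)(R) = R₁₃ R₂₃` and `R¹ q R² = 1`, then `R₂₁ = Δ(R¹) (q R² ⊗ 1)`. -/
theorem sum_comul_left_mul_tmul_one {r s : ι → H}
    (hΔ : ∑ i, TensorProduct.assoc k H H H (comul (R := k) (r i) ⊗ₜ[k] s i) =
      ∑ i, ∑ j, r i ⊗ₜ[k] (r j ⊗ₜ[k] (s i * s j)))
    {q : H} (hq : ∑ i, r i * q * s i = 1) :
    ∑ i, comul (R := k) (r i) * ((q * s i) ⊗ₜ[k] (1 : H)) = ∑ i, s i ⊗ₜ[k] r i := by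
  let F : H ⊗[k] (H ⊗[k] H) →ₗ[k] H ⊗[k] H :=
    (LinearMap.mul' k H ∘ₗ (LinearMap.mulLeft k q).lTensor H).rTensor H ∘ₗ
      (TensorProduct.assoc k H H H).symm.toLinearMap ∘ₗ
      ((TensorProduct.comm k H H).toLinearMap).lTensor H
  have hF (z : H ⊗[k] H) (c : H) :
      F (TensorProduct.assoc k H H H (z ⊗ₜ c)) = z * ((q * c) ⊗ₜ 1) := by
    induction z with
    | zero => simp
    | tmul a b => simp [F]
    | add a b ha hb => rw [TensorProduct.add_tmul, map_add, map_add, ha, hb, add_mul]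
  have h := congrArg F hΔ
  simp only [map_sum, hF] at h
  rw [h, Finset.sum_comm]
  refine Finset.sum_congr rfl fun i _ => ?_
  simp only [F, LinearMap.lTensor_tmul, LinearMap.rTensor_tmul, LinearMap.comp_apply,
    LinearEquiv.coe_coe, TensorProduct.assoc_symm_tmul,
    TensorProduct.comm_tmul, LinearMap.mul'_apply, LinearMap.mulLeft_apply, ← mul_assoc,
    ← TensorProduct.sum_tmul, ← Finset.sum_mul, hq, one_mul]

/-- Let `R = R¹ ⊗ R²` satisfy `R Δ = Δ^cop R`, `(Δ ⊗ id)(R) = R₁₃ R₂₃` and `ε(R¹) R² = 1`. If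
`R² p R¹ = 1` and `R¹ q R² = 1`, then `p a⁻¹ = q α(R¹) R²`. It is obtained from
`R Δ(x) = Δ^cop(x) R` by applying a left integral to the first tensor factor. No relation between
`p` and `q` is assumed, so that the statement applies both to `R` and to `R₂₁⁻¹`. -/
theorem mul_inv_modularElement_eq {Λ : H →ₗ[k] k} (hΛ : Λ ∈ leftIntegrals k H) (h0 : Λ ≠ 0)
    {a : GroupLike k H} (ha : IsModularElement a) {α : H →ₐ[k] k} (hα : IsModularFunctional α)
    {r s : ι → H}
    (hcop : ∀ x : H, (∑ i, r i ⊗ₜ[k] s i) * comul (R := k) x =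
      TensorProduct.comm k H H (comul (R := k) x) * ∑ i, r i ⊗ₜ[k] s i)
    (hΔ : ∑ i, TensorProduct.assoc k H H H (comul (R := k) (r i) ⊗ₜ[k] s i) =
      ∑ i, ∑ j, r i ⊗ₜ[k] (r j ⊗ₜ[k] (s i * s j)))
    (hε : ∑ i, counit (R := k) (r i) • s i = 1)
    {p q : H} (hp : ∑ i, s i * p * r i = 1) (hq : ∑ i, r i * q * s i = 1) :
    p * ((a⁻¹ : GroupLike k H) : H) = q * ∑ i, α (r i) • s i := by
  obtain ⟨χ, hχ, rfl⟩ := hα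
  let Q : H ⊗[k] H →ₗ[k] H := (TensorProduct.lid k H).toLinearMap ∘ₗ Λ.rTensor H
  have hQmul (y : H) (z : H ⊗[k] H) : Q ((1 ⊗ₜ y) * z) = y * Q z := by
    induction z with
    | zero => simp
    | tmul b c => simp [Q]
    | add a b ha hb => simp [mul_add, ha, hb]
  have hQcomm (z : H ⊗[k] H) (y : H) :
      Q (TensorProduct.comm k H H (z * (y ⊗ₜ 1))) = Q (TensorProduct.comm k H H z) * y := by
    induction z with
    | zero => simp
    | tmul b c => simp [Q]
    | add a b ha hb => simp [add_mul, ha, hb]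
  have hQΔ (x : H) : Q (comul x) = Λ x • ((a⁻¹ : GroupLike k H) : H) := ha Λ hΛ x
  have hQcop (x : H) : Q (TensorProduct.comm k H H (comul x)) = Λ x • (1 : H) := by
    rw [← hΛ x]
    induction comul (R := k) x with
    | zero => simp
    | tmul b c => simp [Q]
    | add a b ha hb => simp only [map_add, ha, hb]
  have hcommmul (z w : H ⊗[k] H) : TensorProduct.comm k H H (z * w) =
      TensorProduct.comm k H H z * TensorProduct.comm k H H w :=
    map_mul (Algebra.TensorProduct.comm k H H) z w
  have hleft (x : H) : Q ((∑ i, r i ⊗ₜ[k] s i) * comul x) =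
      ∑ i, Λ (r i * x) • (s i * p * ((a⁻¹ : GroupLike k H) : H)) := by
    rw [← sum_one_tmul_mul_comul_left hΔ hp]
    simp only [Finset.sum_mul, mul_assoc _ (comul (R := k) _), ← Bialgebra.comul_mul, map_sum,
      hQmul, hQΔ, mul_smul_comm]
  have hright (x : H) : Q (TensorProduct.comm k H H (comul x) * ∑ i, r i ⊗ₜ[k] s i) =
      ∑ i, Λ (x * r i) • (q * s i) := by
    have h : ∑ i, r i ⊗ₜ[k] s i = TensorProduct.comm k H H (∑ i, s i ⊗ₜ[k] r i) := by simp
    rw [h, ← hcommmul, ← sum_comul_left_mul_tmul_one hΔ hq]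
    simp only [Finset.mul_sum, ← mul_assoc (comul (R := k) x), ← Bialgebra.comul_mul, map_sum,
      hQcomm, hQcop, smul_mul_assoc, one_mul]
  have hmain (x : H) : ∑ i, Λ (r i * x) • (s i * p * ((a⁻¹ : GroupLike k H) : H)) =
      ∑ i, Λ (χ (r i) * x) • (q * s i) := by
    rw [← hleft, hcop, hright]
    exact Finset.sum_congr rfl fun i _ => by rw [hχ Λ hΛ]
  have hnondeg (y : H) (hy : ∀ x, Λ (y * x) = 0) : y = 0 := by
    have h : χ.symm y = 0 := eq_zero_of_integral_mul_eq_zero hΛ h0 fun x => by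
      rw [hχ Λ hΛ, AlgEquiv.apply_symm_apply, hy]
    simpa using h
  -- A functional on the second tensor factor reduces the cancellation of `Λ(- x)` to `H` itself.
  have hfunc (f : H →ₗ[k] k) : ∑ i, f (s i * p * ((a⁻¹ : GroupLike k H) : H)) • r i =
      ∑ i, f (q * s i) • χ (r i) := by
    rw [← sub_eq_zero]
    refine hnondeg _ fun x => ?_
    have h := congrArg f (hmain x)
    simp only [map_sum, map_smul, smul_eq_mul] at h
    simp only [sub_mul, Finset.sum_mul, smul_mul_assoc, map_sub, map_sum, map_smul, smul_eq_mul,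
      mul_comm (f _), h, sub_self]
  -- Applying the counit to the first tensor factor turns `χ` into `α = ε ∘ χ`.
  refine (Module.forall_dual_apply_eq_zero_iff k _).mp ?_ |> sub_eq_zero.mp
  intro f
  have h := congrArg (counit (R := k)) (hfunc f)
  simp only [map_sum, map_smul, smul_eq_mul] at h
  have hl : p * ((a⁻¹ : GroupLike k H) : H) =
      ∑ i, counit (R := k) (r i) • (s i * p * ((a⁻¹ : GroupLike k H) : H)) := by
    simp only [← smul_mul_assoc, ← Finset.sum_mul, hε, one_mul]
  rw [map_sub, sub_eq_zero, hl]
  simpa [Finset.mul_sum, mul_comm] using h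

end RMatrix
/-! ### The Drinfeld element and the inverse of the R-matrix -/

section Drinfeld

variable {k H : Type*} [Field k] [Ring H] [HopfAlgebra k H] {ι : Type*} [Fintype ι]

/-- `R² u R¹ = 1` for `u = S(R²) R¹`. -/
theorem sum_mul_drinfeldU_mul {r s : ι → H}
    (hΔ : ∑ i, r i ⊗ₜ[k] comul (R := k) (s i) =
      ∑ i, ∑ j, (r i * r j) ⊗ₜ[k] (s j ⊗ₜ[k] s i))
    (hε : ∑ i, counit (R := k) (s i) • r i = 1) :
    ∑ i, s i * (∑ j, antipode k (s j) * r j) * r i = 1 := by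
  let F : H ⊗[k] (H ⊗[k] H) →ₗ[k] H :=
    LinearMap.mul' k H ∘ₗ (TensorProduct.comm k H H).toLinearMap ∘ₗ
      (LinearMap.mul' k H ∘ₗ (antipode k (A := H)).lTensor H).lTensor H
  have h := congrArg F hΔ
  simp only [F, map_sum, LinearMap.comp_apply, LinearMap.lTensor_tmul, LinearEquiv.coe_coe,
    mul_antipode_lTensor_comul_apply, TensorProduct.comm_tmul, LinearMap.mul'_apply,
    ← Algebra.smul_def, hε] at h
  rw [h, Finset.sum_comm]
  simp only [Finset.mul_sum, Finset.sum_mul, mul_assoc]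

/-- `S(x₂) u x₁ = ε(x) u`. -/
theorem sum_antipode_mul_drinfeldU_mul {r s : ι → H}
    (hcop : ∀ x : H, (∑ i, r i ⊗ₜ[k] s i) * comul (R := k) x =
      TensorProduct.comm k H H (comul (R := k) x) * ∑ i, r i ⊗ₜ[k] s i)
    {x : H} {κ : Type*} (𝓡 : Repr k x κ) :
    ∑ j ∈ 𝓡.index, antipode k (𝓡.right j) * (∑ i, antipode k (s i) * r i) * 𝓡.left j =
      counit (R := k) x • ∑ i, antipode k (s i) * r i := by
  let F : H ⊗[k] H →ₗ[k] H := LinearMap.mul' k H ∘ₗ (TensorProduct.comm k H H).toLinearMap ∘ₗ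
    (antipode k (A := H)).lTensor H
  have h := congrArg F (hcop x)
  rw [← 𝓡.eq] at h
  simp only [F, map_sum, Finset.sum_mul, Finset.mul_sum, Algebra.TensorProduct.tmul_mul_tmul,
    LinearMap.comp_apply, LinearMap.lTensor_tmul, LinearEquiv.coe_coe, TensorProduct.comm_tmul,
    LinearMap.mul'_apply, antipode_mul_antidistrib] at h
  have hr (i : ι) :
      ∑ j ∈ 𝓡.index, antipode k (s i) * antipode k (𝓡.left j) * (𝓡.right j * r i) =
      counit (R := k) x • (antipode k (s i) * r i) := by
    have h1 := congrArg (fun z => antipode k (s i) * z * r i) (sum_antipode_mul_eq_smul 𝓡)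
    simpa [Finset.mul_sum, Finset.sum_mul, mul_assoc] using h1
  simp only [hr] at h
  rw [Finset.smul_sum, ← h]
  simp only [Finset.mul_sum, Finset.sum_mul, mul_assoc]

/-- `u x = S²(x) u`: both sides are `S²(x₃) S(x₂) u x₁`. -/
theorem drinfeldU_mul {r s : ι → H}
    (hcop : ∀ x : H, (∑ i, r i ⊗ₜ[k] s i) * comul (R := k) x =
      TensorProduct.comm k H H (comul (R := k) x) * ∑ i, r i ⊗ₜ[k] s i) (x : H) :
    (∑ i, antipode k (s i) * r i) * x =
      antipode k (antipode k x) * ∑ i, antipode k (s i) * r i := by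
  set u := ∑ i, antipode k (s i) * r i with hu
  let F : H ⊗[k] (H ⊗[k] H) →ₗ[k] H :=
    LinearMap.mul' k H ∘ₗ (TensorProduct.comm k H H).toLinearMap ∘ₗ
      TensorProduct.map (LinearMap.mulLeft k u) (antipode k ∘ₗ LinearMap.mul' k H ∘ₗ
        (antipode k (A := H)).lTensor H)
  have hF (a b c : H) : F (a ⊗ₜ (b ⊗ₜ c)) =
      antipode k (antipode k c) * (antipode k b * u * a) := by
    simp [F, antipode_mul_antidistrib, mul_assoc]
  have hl (i) : ∑ j ∈ (ℛ k ((ℛ k x).left i)).index,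
      antipode k ((ℛ k ((ℛ k x).left i)).right j) * u * (ℛ k ((ℛ k x).left i)).left j =
      counit (R := k) ((ℛ k x).left i) • u :=
    sum_antipode_mul_drinfeldU_mul hcop _
  have h := congrArg F (sum_tmul_tmul_eq (ℛ k x)
    (fun i => ℛ k ((ℛ k x).left i)) (fun i => ℛ k ((ℛ k x).right i)))
  simp only [map_sum, hF] at h
  simp only [← Finset.mul_sum, hl] at h
  have hr (i) : ∑ j ∈ (ℛ k ((ℛ k x).right i)).index,
      antipode k (antipode k ((ℛ k ((ℛ k x).right i)).right j)) *
        (antipode k ((ℛ k ((ℛ k x).right i)).left j) * u * (ℛ k x).left i) =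
      u * counit (R := k) ((ℛ k x).right i) • (ℛ k x).left i := by
    have h1 := congrArg (fun z => antipode k z * u * (ℛ k x).left i)
      (sum_mul_antipode_eq_smul (ℛ k ((ℛ k x).right i)))
    simpa [Finset.sum_mul, antipode_mul_antidistrib, mul_assoc] using h1
  rw [Finset.sum_congr rfl fun i _ => hr i, ← Finset.mul_sum, sum_counit_smul_left] at h
  rw [← h]
  conv_rhs => rw [← sum_counit_smul (ℛ k x)]
  simp [Finset.sum_mul]

/-- The element `S(R¹) ⊗ R²` is a left inverse of `R`. -/
theorem sum_antipode_tmul_mul {r s : ι → H}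
    (hΔ : ∑ i, TensorProduct.assoc k H H H (comul (R := k) (r i) ⊗ₜ[k] s i) =
      ∑ i, ∑ j, r i ⊗ₜ[k] (r j ⊗ₜ[k] (s i * s j)))
    (hε : ∑ i, counit (R := k) (r i) • s i = 1) :
    (∑ i, antipode k (r i) ⊗ₜ[k] s i) * ∑ i, r i ⊗ₜ[k] s i = 1 := by
  let F : H ⊗[k] (H ⊗[k] H) →ₗ[k] H ⊗[k] H :=
    (LinearMap.mul' k H ∘ₗ (antipode k (A := H)).rTensor H).rTensor H ∘ₗ
      (TensorProduct.assoc k H H H).symm.toLinearMap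
  have h := congrArg F hΔ
  simp only [F, map_sum, LinearMap.comp_apply, LinearEquiv.coe_coe, LinearEquiv.symm_apply_apply,
    LinearMap.rTensor_tmul, TensorProduct.assoc_symm_tmul, mul_antipode_rTensor_comul_apply,
    LinearMap.mul'_apply, Algebra.algebraMap_eq_smul_one, TensorProduct.smul_tmul] at h
  rw [← TensorProduct.tmul_sum, hε] at h
  rw [Finset.sum_mul_sum, Algebra.TensorProduct.one_def, h]
  simp only [Algebra.TensorProduct.tmul_mul_tmul]

/-- The element `S(R¹) ⊗ R²` is a left inverse of `S(R¹) ⊗ S(R²)`. As it is also the inverse of `R`,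
this shows that `S ⊗ S` fixes `R`. -/
theorem sum_antipode_tmul_mul_antipode {r s : ι → H}
    (hΔ : ∑ i, r i ⊗ₜ[k] comul (R := k) (s i) =
      ∑ i, ∑ j, (r i * r j) ⊗ₜ[k] (s j ⊗ₜ[k] s i))
    (hε : ∑ i, counit (R := k) (s i) • r i = 1) :
    (∑ i, antipode k (r i) ⊗ₜ[k] s i) * ∑ i, antipode k (r i) ⊗ₜ[k] antipode k (s i) = 1 := by
  let F : H ⊗[k] (H ⊗[k] H) →ₗ[k] H ⊗[k] H :=
    TensorProduct.map (antipode k) (LinearMap.mul' k H ∘ₗ (antipode k (A := H)).lTensor H)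
  have h := congrArg F hΔ
  simp only [F, map_sum, TensorProduct.map_tmul, LinearMap.comp_apply, LinearMap.lTensor_tmul,
    mul_antipode_lTensor_comul_apply, LinearMap.mul'_apply, Algebra.algebraMap_eq_smul_one,
    ← TensorProduct.smul_tmul, ← TensorProduct.sum_tmul, ← map_smul] at h
  rw [← map_sum, hε, antipode_one] at h
  rw [Finset.sum_mul_sum, Algebra.TensorProduct.one_def, h, Finset.sum_comm]
  simp only [Algebra.TensorProduct.tmul_mul_tmul, antipode_mul_antidistrib]

end Drinfeld
/-! ### Comparison of the Drinfeld element with the modular elements -/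

section Comparison

variable {k H : Type*} [Field k] [Ring H] [HopfAlgebra k H]

/-- A nonzero right integral yields a nonzero left integral once the antipode is surjective, which
for quasitriangular `H` follows from `S²` being inner. -/
theorem exists_leftIntegral_ne_zero (hH : IsCoFrobenius k H)
    (hS : Function.Surjective (antipode k (A := H))) : ∃ Λ ∈ leftIntegrals k H, Λ ≠ 0 := by
  rcases hH with h | h
  · exact (Submodule.ne_bot_iff _).mp h
  · obtain ⟨Λ, hΛ, h0⟩ := (Submodule.ne_bot_iff _).mp h
    refine ⟨_, comp_antipode_mem_leftIntegrals hΛ, fun hz => h0 ?_⟩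
    ext x
    obtain ⟨y, rfl⟩ := hS x
    exact LinearMap.congr_fun hz y

end Comparison

end CoFrob

open CoFrob Coalgebra HopfAlgebra in
theorem theorem2p2 {k H : Type*} [Field k] [Ring H] [HopfAlgebra k H]
    (hH : CoFrob.IsCoFrobenius k H)
    (R : (H ⊗[k] H)ˣ) (hR : CoFrob.IsQuasitriangular R)
    (a : GroupLike k H) (ha : CoFrob.IsModularElement a)
    (α : H →ₐ[k] k) (hα : CoFrob.IsModularFunctional α) :
    IsUnit (HopfAlgebra.antipode k (CoFrob.drinfeldU (R : H ⊗[k] H))) ∧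
    CoFrob.drinfeldU (R : H ⊗[k] H) * CoFrob.drinfeldV (R : H ⊗[k] H) =
      CoFrob.drinfeldV (R : H ⊗[k] H) * CoFrob.drinfeldU (R : H ⊗[k] H) ∧
    CoFrob.drinfeldV (R : H ⊗[k] H) * CoFrob.drinfeldU (R : H ⊗[k] H) =
      (a : H) * CoFrob.bElem (R : H ⊗[k] H) α ∧
    (a : H) * CoFrob.bElem (R : H ⊗[k] H) α = (a : H) * CoFrob.aElem (R : H ⊗[k] H) α ∧
    CoFrob.aElem (R : H ⊗[k] H) α = CoFrob.bElem (R : H ⊗[k] H) α := by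
  obtain ⟨n, r, s, hrs⟩ := TensorProduct.exists_sum_tmul_eq (R : H ⊗[k] H)
  obtain ⟨hcop, hΔl, hΔr, hεl, hεr⟩ := hR
  replace hcop (x : H) : (R : H ⊗[k] H) * comul (R := k) x =
      TensorProduct.comm k H H (comul (R := k) x) * (R : H ⊗[k] H) := by
    rw [hcop, Units.inv_mul_cancel_right]
  have hcop' (x : H) : ((R⁻¹ : (H ⊗[k] H)ˣ) : H ⊗[k] H) *
      TensorProduct.comm k H H (comul (R := k) x) =
      comul (R := k) x * ((R⁻¹ : (H ⊗[k] H)ˣ) : H ⊗[k] H) := by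
    rw [Units.inv_mul_eq_iff_eq_mul, ← mul_assoc, hcop, Units.mul_inv_cancel_right]
  rw [hrs] at hcop hΔl hΔr hεl hεr
  simp only [map_sum, LinearMap.rTensor_tmul, LinearMap.lTensor_tmul, TensorProduct.lid_tmul,
    TensorProduct.rid_tmul, leg12, leg13, leg23, TensorProduct.tmul_sum, Finset.sum_mul_sum,
    Algebra.TensorProduct.map_tmul, Algebra.TensorProduct.includeLeft_apply,
    Algebra.TensorProduct.includeRight_apply, AlgHom.id_apply,
    Algebra.TensorProduct.tmul_mul_tmul, mul_one, one_mul] at hΔl hΔr hεl hεr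
  -- The inverse of `R` is `S(R¹) ⊗ R²`, and `R` is fixed by `S ⊗ S`.
  have hinv : ((R⁻¹ : (H ⊗[k] H)ˣ) : H ⊗[k] H) = ∑ i, antipode k (r i) ⊗ₜ[k] s i := by
    rw [Units.inv_eq_of_mul_eq_one_left]
    rw [hrs, sum_antipode_tmul_mul hΔl hεl]
  have hSS : ∑ i, antipode k (r i) ⊗ₜ[k] antipode k (s i) = ∑ i, r i ⊗ₜ[k] s i := by
    rw [← hrs]
    exact (R⁻¹).mul_right_inj.mp
      (by rw [Units.inv_mul, hinv, sum_antipode_tmul_mul_antipode hΔr hεr])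
  set u : H := ∑ i, antipode k (s i) * r i with hu
  have huR : drinfeldU (R : H ⊗[k] H) = u := by
    simp [drinfeldU, hrs, hu]
  have hux (x : H) : u * x = antipode k (antipode k x) * u := drinfeldU_mul hcop x
  have hsur : ∑ i, s i * u * r i = 1 := sum_mul_drinfeldU_mul hΔr hεr
  have hSS2 : ∑ i, antipode k (antipode k (r i)) ⊗ₜ[k] antipode k (antipode k (s i)) =
      ∑ i, r i ⊗ₜ[k] s i := by
    have h := congrArg (TensorProduct.map (antipode k (A := H)) (antipode k)) hSS
    simp only [map_sum, TensorProduct.map_tmul] at h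
    rw [h, hSS]
  -- The element `R² S²(R¹)` is the inverse of `u`.
  set w : H := ∑ i, s i * antipode k (antipode k (r i)) with hw
  have hwu : w * u = 1 := by
    simpa only [hw, Finset.sum_mul, mul_assoc, ← hux] using hsur
  have huw : u * w = 1 := by
    have h := congrArg (LinearMap.mul' k H ∘ₗ (TensorProduct.comm k H H).toLinearMap ∘ₗ
      (LinearMap.mulRight k u).lTensor H) hSS2
    simp only [map_sum, LinearMap.comp_apply, LinearMap.lTensor_tmul, LinearEquiv.coe_coe,
      TensorProduct.comm_tmul, LinearMap.mul'_apply, LinearMap.mulRight_apply, hsur] at h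
    rw [← h, hw, Finset.mul_sum]
    exact Finset.sum_congr rfl fun i _ => by rw [← mul_assoc, hux]
  have hS2u : antipode k (antipode k u) = u := by
    have h := congrArg (· * w) (hux u)
    simpa only [mul_assoc, huw, mul_one] using h.symm
  have hS2 (x : H) : antipode k (antipode k x) = u * x * w := by
    rw [hux, mul_assoc, huw, mul_one]
  have hSsurj : Function.Surjective (antipode k (A := H)) := fun x => by
    refine ⟨antipode k (w * x * u), ?_⟩
    rw [hS2, mul_assoc, mul_assoc, mul_assoc, huw, mul_one, ← mul_assoc, huw, one_mul]
  -- The inverse of `S(u)` is `S(u⁻¹)`.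
  set v : H := antipode k w with hv
  have hSuv : antipode k u * v = 1 := by rw [hv, ← antipode_mul_antidistrib, hwu, antipode_one]
  have hvSu : v * antipode k u = 1 := by rw [hv, ← antipode_mul_antidistrib, huw, antipode_one]
  have hvx (x : H) : v * x = antipode k (antipode k x) * v := by
    obtain ⟨y, rfl⟩ := hSsurj x
    have h := congrArg (antipode k (A := H)) (hux y)
    rw [antipode_mul_antidistrib, antipode_mul_antidistrib] at h
    calc v * antipode k y = v * (antipode k y * antipode k u) * v := by
          rw [mul_assoc, mul_assoc, hSuv, mul_one]
      _ = _ := by rw [h, ← mul_assoc, hvSu, one_mul]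
  have hcomm : u * v = v * u := by rw [hvx, hS2u]
  -- Applying `S` to `R² u R¹ = 1`, and using that `S ⊗ S` fixes `R`.
  have hSur : ∑ i, r i * antipode k u * s i = 1 := by
    have h := congrArg (LinearMap.mul' k H ∘ₗ (LinearMap.mulLeft k (antipode k u)).lTensor H) hSS
    simp only [map_sum, LinearMap.comp_apply, LinearMap.lTensor_tmul, LinearMap.mul'_apply,
      LinearMap.mulLeft_apply] at h
    simp only [mul_assoc, ← h, ← antipode_mul_antidistrib, ← map_sum]
    simp only [← mul_assoc, hsur, antipode_one]
  obtain ⟨Λ, hΛ, h0⟩ := exists_leftIntegral_ne_zero hH hSsurj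
  -- `u a⁻¹ = S(u) a_α`.
  have h1 := mul_inv_modularElement_eq hΛ h0 ha hα hcop hΔl hεl hsur hSur
  -- The same identity for the R-matrix `R₂₁⁻¹ = R² ⊗ S(R¹)`, whose Drinfeld element is `S(u)⁻¹`.
  have hcop21 (x : H) : (∑ i, s i ⊗ₜ[k] antipode k (r i)) * comul (R := k) x =
      TensorProduct.comm k H H (comul (R := k) x) * ∑ i, s i ⊗ₜ[k] antipode k (r i) := by
    have h := congrArg (Algebra.TensorProduct.comm k H H) (hcop' x)
    rw [map_mul, map_mul, hinv] at h
    have hc : Algebra.TensorProduct.comm k H H (TensorProduct.comm k H H (comul (R := k) x)) =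
        comul (R := k) x := (TensorProduct.comm k H H).symm_apply_apply _
    rw [hc, map_sum] at h
    simp only [Algebra.TensorProduct.comm_tmul] at h
    exact h
  have hΔ21 : ∑ i, TensorProduct.assoc k H H H (comul (R := k) (s i) ⊗ₜ[k] antipode k (r i)) =
      ∑ i, ∑ j, s i ⊗ₜ[k] (s j ⊗ₜ[k] (antipode k (r i) * antipode k (r j))) := by
    have h := congrArg ((TensorProduct.assoc k H H H).toLinearMap ∘ₗ
      (TensorProduct.comm k H (H ⊗[k] H)).toLinearMap ∘ₗ
      (antipode k (A := H)).rTensor (H ⊗[k] H)) hΔr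
    simp only [map_sum, LinearMap.comp_apply, LinearMap.rTensor_tmul, LinearEquiv.coe_coe,
      TensorProduct.comm_tmul, TensorProduct.assoc_tmul, antipode_mul_antidistrib] at h
    rw [h, Finset.sum_comm]
  have hε21 : ∑ i, counit (R := k) (s i) • antipode k (r i) = 1 := by
    simp only [← map_smul, ← map_sum, hεr, antipode_one]
  have hp21 : ∑ i, antipode k (r i) * v * s i = 1 := by
    simp only [mul_assoc, hvx]
    simp only [← mul_assoc, ← antipode_mul_antidistrib, ← Finset.sum_mul, ← map_sum, ← hu, hSuv]
  have hq21 : ∑ i, s i * w * antipode k (r i) = 1 := by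
    have h := congrArg (LinearMap.mul' k H ∘ₗ (TensorProduct.comm k H H).toLinearMap ∘ₗ
      TensorProduct.map (antipode k) (LinearMap.mulRight k w)) hSS
    simp only [map_sum, LinearMap.comp_apply, TensorProduct.map_tmul, LinearEquiv.coe_coe,
      TensorProduct.comm_tmul, LinearMap.mul'_apply, LinearMap.mulRight_apply, hS2] at h
    rw [← h]
    simp only [mul_assoc]
    simp only [← mul_assoc w u, hwu, one_mul]
    simp only [← mul_assoc, ← Finset.sum_mul, ← hu, huw]
  -- `S(u)⁻¹ a⁻¹ = u⁻¹ b_α`, with `b_α` in the form `α(R²) S(R¹)`.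
  have h2 := mul_inv_modularElement_eq hΛ h0 ha hα hcop21 hΔ21 hε21 hp21 hq21
  have hαS (x : H) : α (antipode k (antipode k x)) = α x := by
    rw [hS2, map_mul, map_mul, mul_right_comm, ← map_mul, huw, map_one, one_mul]
  have hA : aElem (R : H ⊗[k] H) α = v * u * ((a⁻¹ : GroupLike k H) : H) := by
    rw [mul_assoc, h1, ← mul_assoc, hvSu, one_mul]
    simp [aElem, hrs]
  have hB : bElem (R : H ⊗[k] H) α = u * v * ((a⁻¹ : GroupLike k H) : H) := by
    have h := congrArg ((TensorProduct.rid k H).toLinearMap ∘ₗ (convInverse α).lTensor H) hSS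
    simp only [map_sum, LinearMap.comp_apply, LinearMap.lTensor_tmul, LinearEquiv.coe_coe,
      TensorProduct.rid_tmul, convInverse, AlgHom.toLinearMap_apply, hαS] at h
    rw [mul_assoc, h2, ← mul_assoc, huw, one_mul, h]
    simp [bElem, hrs, convInverse]
  have hAB : aElem (R : H ⊗[k] H) α = bElem (R : H ⊗[k] H) α := by rw [hA, hB, hcomm]
  have hvu : v * u = (a : H) * bElem (R : H ⊗[k] H) α := by
    have haS : antipode k (antipode k (a : H)) = a := a.2.antipode_antipode
    have hainv : (a : H) * ((a⁻¹ : GroupLike k H) : H) = 1 := a.2.mul_antipode_cancel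
    have hav : (a : H) * v = v * a := by rw [hvx, haS]
    have hau : (a : H) * u = u * a := by rw [hux, haS]
    rw [hB, ← mul_assoc, ← mul_assoc, hau, mul_assoc u, hav, ← mul_assoc, mul_assoc (u * v),
      hainv, mul_one, hcomm]
  have hunit : IsUnit (antipode k u) := ⟨⟨_, v, hSuv, hvSu⟩, rfl⟩
  have hV : drinfeldV (R : H ⊗[k] H) = v := by
    rw [drinfeldV, huR]
    exact Ring.inverse_unit ⟨_, v, hSuv, hvSu⟩
  rw [huR, hV]
  exact ⟨hunit, hcomm, hvu, by rw [hAB], hAB⟩
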